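/- Let $N\cong\mathbf Z^d$ be a lattice, $M=\operatorname{Hom}(N,\mathbf Z)$, and let $\langle\ ,\ \rangle$ be the pairing. A \emph{nef-partition} in $M_{\mathbf R}$ is a collection $\Delta_1,\dots,\Delta_r$ of non-zero integral polytopes (convex hulls of finitely many lattice points, different from $\{0\}$), each containing $0$, whose Minkowski sum is reflexive, i.e. the sum and its polar dual $\{w : \langle w,p\rangle\ge -1 \text{ for all } p\in\sum_k\Delta_k\}$ are both integral polytopes. Its \emph{Borisov dual} is $\nabla_k=\{v\in N_{\mathbf R} : \langle m,v\rangle+\delta(k',k)\ge 0 \text{ for all } k' \text{ and all } m\in\Delta_{k'}\}$, where $\delta$ is the Kronecker delta. Two nef-partitions $\Delta^{(1)}_1,\dots,\Delta^{(1)}_r$ and $\Delta^{(2)}_1,\dots,\Delta^{(2)}_r$ in $M_{\mathbf R}$ are \emph{multiple mirrors} if there are $n_1,\dots,n_r\in N$ with $\sum_k n_k=0$ such that the Borisov duals satisfy $\nabla^{(2)}_k=\nabla^{(1)}_k+n_k$ for all $k$. Given multiple mirror nef-partitions, let $\overline M=M\oplus\bigoplus_{k}\mathbf Z e_k$, let $\iota_1$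 be the identity of $\overline M$, and let $\iota_2(m,x)=(m,(x_k+\langle m,n_k\rangle)_k)$. Let $\tilde\Delta=\operatorname{conv}\bigl(\bigcup_k(\Delta^{(1)}_k+e_k)\bigr)$, $\Xi=\tilde\Delta\cap\overline M$, and $\Lambda^{(i)}_k=\{\chi\in\Xi : \chi=\iota_i(m+e_k) \text{ for some } m\in\Delta^{(i)}_k\cap M\}$ for $i=1,2$. Let $C=(\mathbf C^*)^{\Xi}$ be the torus of coefficients $c=(c_\chi)_{\chi\in\Xi}$ and let $T=\operatorname{Hom}(\overline M,\mathbf C^*)\times C$. Let $(W)$ be the $r\times r$ matrix of functions on $T$ with entries $$W_{ab}=\sum_{\chi\in\Lambda^{(1)}_a\cap\Lambda^{(2)}_b}c_\chi\,\chi ,$$ and let $\beta$ be the number of connected components of the directed graph $D$ on $\{1,\dots,r\}$ that has an arrow from $a$ to $b$ when $\Lambda^{(1)}_a\cap\Lambda^{(2)}_b\ne\varnothing$. For $i=1,2$ let $Y^{(i)}_-$ be the complex projective toric variety of the polytope $\sum_k\Delta^{(i)}_k$, let $\mathcal L^{(i)}_k$ be the line bundle on it whose global sections have the characters in $\Delta^{(i)}_k\cap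 M$ as a basis, and let $Y^{(i)}=Y^{(i)}_-\times C$. Let $Z^{(i)}\subseteq Y^{(i)}$ be the vanishing locus of the universal section $g^{(i)}$ of $\bigoplus_k\mathcal L^{(i)}_k$, whose $k$-th component is $\sum_m c_{\iota_i(m+e_k)}\,\chi^m$, summed over $m\in\Delta^{(i)}_k\cap M$. Let $T\to Y^{(i)}$ be the product of the identity of $C$ with the map to the big torus $\operatorname{Hom}(M,\mathbf C^*)$ of $Y^{(i)}_-$ that is dual to $m\mapsto\iota_i(m,0)$. Let $S^{(i)}\subseteq T$ be the preimage of $Z^{(i)}$, let $R^{(i)}\subseteq S^{(i)}$ be the set of points at which $(W)$ has rank $r-\beta$, and let $\Omega^{(i)}\subseteq Z^{(i)}$ be the image of $R^{(1)}\cap R^{(2)}$. Then $\Omega^{(1)}$ and $\Omega^{(2)}$ are non-empty. -/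

import Mathlib

open scoped Pointwise

noncomputable section

namespace NefMirror

/-! The lattices `N` and `M = Hom(N, ℤ)` of rank `d` are written as `Fin d → ℤ`, with `N_ℝ` and
`M_ℝ` written as `Fin d → ℝ`; after the choice of a basis of `N` and the dual basis of `M`, the
canonical pairing is the dot product `⬝ᵥ`. -/

/-- The inclusion of the lattice into the real vector space it spans. -/
def toReal {d : ℕ} (m : Fin d → ℤ) : Fin d → ℝ := fun j => (m j : ℝ)

/-! ### Polytopes and nef-partitions -/

/-- An integral compact convex polytope: the convex hull of a finite set of lattice points. -/
def IsIntegralPolytope {d : ℕ} (P : Set (Fin d → ℝ)) : Prop :=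
  ∃ S : Finset (Fin d → ℤ), P = convexHull ℝ (toReal '' (S : Set (Fin d → ℤ)))

/-- The polar dual `{w | ⟨w, p⟩ ≥ -1 for all p ∈ P}`. -/
def polarDual {d : ℕ} (P : Set (Fin d → ℝ)) : Set (Fin d → ℝ) :=
  {w | ∀ p ∈ P, -1 ≤ w ⬝ᵥ p}

/-- A reflexive polytope. -/
def IsReflexive {d : ℕ} (P : Set (Fin d → ℝ)) : Prop :=
  IsIntegralPolytope P ∧ IsIntegralPolytope (polarDual P)

/-- A nef-partition: non-zero integral polytopes containing the origin, with reflexive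
Minkowski sum (the sum below is the pointwise sum of sets). -/
structure IsNefPartition {d r : ℕ} (Δ : Fin r → Set (Fin d → ℝ)) : Prop where
  polytope : ∀ k, IsIntegralPolytope (Δ k)
  ne_zero : ∀ k, Δ k ≠ {0}
  zero_mem : ∀ k, (0 : Fin d → ℝ) ∈ Δ k
  reflexive : IsReflexive (∑ k, Δ k)

/-- The Borisov dual of a collection of polytopes: the `k`-th member is the set of those `v` with
`⟨m, v⟩ + δ(k', k) ≥ 0` for all `k'` and all `m` in the `k'`-th polytope. -/
def borisovDual {d r : ℕ} (Δ : Fin r → Set (Fin d → ℝ)) (k : Fin r) : Set (Fin d → ℝ) :=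
  {v | ∀ k', ∀ m ∈ Δ k', 0 ≤ m ⬝ᵥ v + (if k' = k then 1 else 0)}

/-- Two nef-partitions `Δ₁`, `Δ₂` are multiple mirrors, with translation vectors `n k ∈ N`, if
their Borisov duals satisfy `∇₂ k = ∇₁ k + n k` for all `k`, and `∑ k, n k = 0`. -/
structure IsMultipleMirror {d r : ℕ} (Δ₁ Δ₂ : Fin r → Set (Fin d → ℝ))
    (n : Fin r → Fin d → ℤ) : Prop where
  nef₁ : IsNefPartition Δ₁
  nef₂ : IsNefPartition Δ₂
  dual_eq : ∀ k, borisovDual Δ₂ k = (fun v => v + toReal (n k)) '' borisovDual Δ₁ k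
  sum_eq_zero : ∑ k, n k = 0

theorem IsMultipleMirror.zero_mem {d r : ℕ} {Δ : Fin 2 → Fin r → Set (Fin d → ℝ)}
    {n : Fin r → Fin d → ℤ} (h : IsMultipleMirror (Δ 0) (Δ 1) n) (i : Fin 2) (k : Fin r) :
    (0 : Fin d → ℝ) ∈ Δ i k := by
  fin_cases i
  · exact h.nef₁.zero_mem k
  · exact h.nef₂.zero_mem k

/-! ### The projective toric variety of a polytope -/

/-- The graded monoid of lattice points of the cone over a polytope `P`: the pairs `(m, δ)` with
`m` a lattice point of `δ P`. The dilate `δ P` of the convex set `P` is written as the Minkowski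
sum of `δ` copies of `P`. -/
def coneMonoid {d : ℕ} (P : Set (Fin d → ℝ)) : AddSubmonoid ((Fin d → ℤ) × ℕ) where
  carrier := {q | toReal q.1 ∈ ∑ _j ∈ Finset.range q.2, P}
  zero_mem' := by
    have h : toReal (0 : Fin d → ℤ) = 0 := by
      funext j
      simp [toReal]
    simp [h]
  add_mem' := by
    intro a b ha hb
    have h : toReal (a.1 + b.1) = toReal a.1 + toReal b.1 := by
      funext j
      simp [toReal]
    simp only [Set.mem_ofPred_eq, Finset.sum_const, Finset.card_range] at ha hb ⊢
    rw [Prod.fst_add, Prod.snd_add, h, add_nsmul]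
    exact Set.add_mem_add ha hb

/-- Homogeneous coordinates of a point of `Proj ℂ[coneMonoid P]`: a closed point of
`Spec ℂ[coneMonoid P]`, that is, a multiplicative map from the monoid to `ℂ`, which does not lie in
the zero locus of the irrelevant ideal. -/
def HomogCoord {d : ℕ} (P : Set (Fin d → ℝ)) : Type :=
  {y : Multiplicative (coneMonoid P) →* ℂ //
    ∃ q : coneMonoid P, 0 < q.1.2 ∧ y (Multiplicative.ofAdd q) ≠ 0}

/-- Homogeneous coordinates are identified under the action of `ℂˣ` given by the degree. -/
def homogSetoid {d : ℕ} (P : Set (Fin d → ℝ)) : Setoid (HomogCoord P) where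
  r y y' := ∃ u : ℂˣ, ∀ q : coneMonoid P,
    y'.1 (Multiplicative.ofAdd q) = (u : ℂ) ^ q.1.2 * y.1 (Multiplicative.ofAdd q)
  iseqv := by
    refine ⟨fun y => ⟨1, fun q => by simp⟩, ?_, ?_⟩
    · rintro y y' ⟨u, h⟩
      refine ⟨u⁻¹, fun q => ?_⟩
      rw [h q, ← mul_assoc, ← mul_pow]
      simp
    · rintro y y' y'' ⟨u, h⟩ ⟨u', h'⟩
      refine ⟨u' * u, fun q => ?_⟩
      rw [h' q, h q, ← mul_assoc, ← mul_pow]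
      simp

/-- The (complex points of the) projective toric variety `Proj ℂ[coneMonoid P]` of `P`. -/
def ToricVariety {d : ℕ} (P : Set (Fin d → ℝ)) : Type :=
  Quotient (homogSetoid P)

/-! ### Characters of the total space and the superpotential

In the rest of the file, `Δ 0` and `Δ 1` are the two nef-partitions of a multiple mirror pair and
`n` is the family of translation vectors. -/

/-- The character group `M ⊕ ⨁ₖ ℤ eₖ` of the total space. -/
abbrev Mbar (d r : ℕ) : Type := (Fin d → ℤ) × (Fin r → ℤ)

/-- The translation vectors of the dual of `Δ i` relative to the dual of `Δ 0`. -/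
def shift {d r : ℕ} (n : Fin r → Fin d → ℤ) (i : Fin 2) : Fin r → Fin d → ℤ := ![0, n] i

/-- The identification of the character group `M ⊕ ⨁ₖ ℤ eₖ` attached to `Δ i` with the one attached
to `Δ 0`; it is the identity for `i = 0`. For `i = 1` it is the transpose of the isomorphism
`(v, y) ↦ (v + ∑ₖ yₖ nₖ, y)` of the dual lattices, which sends the `k`-th basis vector `e'ₖ` of the
first to `nₖ + e'ₖ` in the second, and so carries `∇₁ k + e'ₖ` onto `∇₂ k + e'ₖ`. -/
def charIdent {d r : ℕ} (n : Fin r → Fin d → ℤ) (i : Fin 2) : Mbar d r →+ Mbar d r where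
  toFun χ := (χ.1, fun k => χ.2 k + χ.1 ⬝ᵥ shift n i k)
  map_zero' := by
    ext <;> simp
  map_add' := by
    intro a b
    refine Prod.ext rfl ?_
    funext k
    simp only [Prod.fst_add, Prod.snd_add, Pi.add_apply, add_dotProduct]
    ring

/-- The polytope `conv (⋃ₖ (Δ k + eₖ))` in `M_ℝ ⊕ ⨁ₖ ℝ eₖ`. -/
def deltaTilde {d r : ℕ} (Δ : Fin r → Set (Fin d → ℝ)) : Set ((Fin d → ℝ) × (Fin r → ℝ)) :=
  convexHull ℝ (⋃ k, (fun x => (x, (Pi.single k 1 : Fin r → ℝ))) '' Δ k)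

/-- The set of characters in the expansion of the superpotential `W`: the lattice points of
`deltaTilde (Δ 0)`. -/
def Xi {d r : ℕ} (Δ : Fin 2 → Fin r → Set (Fin d → ℝ)) : Set (Mbar d r) :=
  {χ | (toReal χ.1, toReal χ.2) ∈ deltaTilde (Δ 0)}

/-- The set of characters in the expansion of the component in the `k`-th line bundle of the `i`-th
bundle: those of the form `m + eₖ` with `m` a lattice point of `Δ i k`. -/
def Lam {d r : ℕ} (Δ : Fin 2 → Fin r → Set (Fin d → ℝ)) (n : Fin r → Fin d → ℤ)
    (i : Fin 2) (k : Fin r) : Set (Xi Δ) :=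
  {χ | ∃ m : Fin d → ℤ, toReal m ∈ Δ i k ∧ χ.1 = charIdent n i (m, Pi.single k 1)}

/-- The points of the coefficient torus `C`, with one coordinate for each character in `W`. -/
abbrev Coeff {d r : ℕ} (Δ : Fin 2 → Fin r → Set (Fin d → ℝ)) : Type := Xi Δ → ℂˣ

/-- The points of the torus `T`, the product of the torus with character group `Mbar d r` and the
coefficient torus. -/
abbrev Torus {d r : ℕ} (Δ : Fin 2 → Fin r → Set (Fin d → ℝ)) : Type :=
  (Multiplicative (Mbar d r) →* ℂˣ) × Coeff Δ

/-- The matrix `(W)` at a point of `T`, with `W_{ab}` the sum of the terms `c_χ χ` of `W` over the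
characters `χ` common to the `a`-th component for `i = 0` and the `b`-th component for `i = 1`. -/
def wMatrix {d r : ℕ} (Δ : Fin 2 → Fin r → Set (Fin d → ℝ)) (n : Fin r → Fin d → ℤ)
    (t : Torus Δ) : Matrix (Fin r) (Fin r) ℂ :=
  Matrix.of fun a b => ∑ᶠ χ : ↥(Lam Δ n 0 a ∩ Lam Δ n 1 b),
    (t.2 χ.1 : ℂ) * (t.1 (Multiplicative.ofAdd χ.1.1) : ℂ)

/-- The directed graph `D`. -/
def dGraph {d r : ℕ} (Δ : Fin 2 → Fin r → Set (Fin d → ℝ)) (n : Fin r → Fin d → ℤ) :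
    Digraph (Fin r) where
  Adj a b := (Lam Δ n 0 a ∩ Lam Δ n 1 b).Nonempty

/-- The number of connected components of `D` (forgetting the directions of the arrows). -/
def beta {d r : ℕ} (Δ : Fin 2 → Fin r → Set (Fin d → ℝ)) (n : Fin r → Fin d → ℤ) : ℕ :=
  Nat.card (dGraph Δ n).toSimpleGraphInclusive.ConnectedComponent

/-! ### The complete intersections and the sets `S`, `R`, `Ω` -/

/-- The points of `Y i = Y₋ i × C`, where `Y₋ i` is the projective toric variety of the polytope
`∑ₖ Δ i k`. -/
abbrev BaseVariety {d r : ℕ} (Δ : Fin 2 → Fin r → Set (Fin d → ℝ)) (i : Fin 2) : Type :=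
  ToricVariety (∑ k, Δ i k) × Coeff Δ

theorem fst_add_mem_coneMonoid {d r : ℕ} {Δ : Fin 2 → Fin r → Set (Fin d → ℝ)}
    {n : Fin r → Fin d → ℤ} {i : Fin 2} {k : Fin r} {χ : Xi Δ} (hχ : χ ∈ Lam Δ n i k)
    {p : Fin d → ℤ} (hp : toReal p ∈ ∑ j ∈ Finset.univ.erase k, Δ i j) :
    (χ.1.1 + p, 1) ∈ coneMonoid (∑ j, Δ i j) := by
  obtain ⟨m, hm, h⟩ := hχ
  have h1 : χ.1.1 = m := by rw [h]; rfl
  have h2 : toReal (m + p) = toReal m + toReal p := by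
    funext j
    simp [toReal]
  change toReal (χ.1.1 + p) ∈ ∑ _j ∈ Finset.range 1, ∑ j, Δ i j
  rw [h1, h2, Finset.sum_range_one, ← Finset.add_sum_erase Finset.univ _ (Finset.mem_univ k)]
  exact Set.add_mem_add hm hp

/-- The product of the `k`-th component `ℓₖ = ∑ c_m m` (sum over the lattice points `m` of `Δ i k`)
of the section `g i` with the section `p` of the tensor product of the other line bundles,
`p` being a lattice point of `∑_{j ≠ k} Δ i j`; it is a section of the line bundle of the polytope
`∑ⱼ Δ i j`, hence a form of degree one in the homogeneous coordinates. -/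
def sectionForm {d r : ℕ} (Δ : Fin 2 → Fin r → Set (Fin d → ℝ)) (n : Fin r → Fin d → ℤ)
    (i : Fin 2) (c : Coeff Δ) (k : Fin r) (p : Fin d → ℤ)
    (hp : toReal p ∈ ∑ j ∈ Finset.univ.erase k, Δ i j) (y : HomogCoord (∑ j, Δ i j)) : ℂ :=
  ∑ᶠ χ : ↥(Lam Δ n i k),
    (c χ.1 : ℂ) * y.1 (Multiplicative.ofAdd ⟨(χ.1.1.1 + p, 1), fst_add_mem_coneMonoid χ.2 hp⟩)

/-- The complete intersection `Z i ⊆ Y i`, the zero locus of the universal section `g i`. The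
sections `p` in `sectionForm` generate the tensor product of the line bundles other than the `k`-th,
so `ℓₖ` vanishes at a point exactly when its products with all of them do. The condition does not
depend on the choice of the homogeneous coordinates `y` of the point. -/
def Z {d r : ℕ} (Δ : Fin 2 → Fin r → Set (Fin d → ℝ)) (n : Fin r → Fin d → ℤ) (i : Fin 2) :
    Set (BaseVariety Δ i) :=
  {z | ∃ y : HomogCoord (∑ j, Δ i j), Quotient.mk (homogSetoid _) y = z.1 ∧
    ∀ (k : Fin r) (p : Fin d → ℤ) (hp : toReal p ∈ ∑ j ∈ Finset.univ.erase k, Δ i j),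
      sectionForm Δ n i z.2 k p hp y = 0}

/-- Homogeneous coordinates of the image in `Y₋ i` of a point of the torus of the total space: the
value at `(m, δ)` is the value of the character `m` pulled back along the projection. -/
def torusCoord {d r : ℕ} {Δ : Fin 2 → Fin r → Set (Fin d → ℝ)} {n : Fin r → Fin d → ℤ}
    (h : IsMultipleMirror (Δ 0) (Δ 1) n) (i : Fin 2) (s : Multiplicative (Mbar d r) →* ℂˣ) :
    HomogCoord (∑ j, Δ i j) :=
  ⟨{  toFun := fun q => (s (Multiplicative.ofAdd (charIdent n i (q.toAdd.1.1, 0))) : ℂ)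
      map_one' := by
        have h1 : charIdent n i ((0 : Fin d → ℤ), (0 : Fin r → ℤ)) = 0 := map_zero (charIdent n i)
        simp [h1]
      map_mul' := by
        intro a b
        have h1 : charIdent n i (a.toAdd.1.1 + b.toAdd.1.1, (0 : Fin r → ℤ)) =
            charIdent n i (a.toAdd.1.1, 0) + charIdent n i (b.toAdd.1.1, 0) := by
          rw [← map_add]
          simp
        simp [h1, ofAdd_add] },
    ⟨⟨(0, 1), by
      change toReal (0 : Fin d → ℤ) ∈ ∑ _j ∈ Finset.range 1, ∑ j, Δ i j
      have h1 : toReal (0 : Fin d → ℤ) = ∑ _j : Fin r, (0 : Fin d → ℝ) := by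
        funext j
        simp [toReal]
      rw [Finset.sum_range_one, h1]
      exact Set.finsetSum_mem_finsetSum _ _ _ fun k _ => h.zero_mem i k⟩, by simp, by simp⟩⟩

/-- The projection of `T ⊆ X i` to `Y i`. -/
def proj {d r : ℕ} {Δ : Fin 2 → Fin r → Set (Fin d → ℝ)} {n : Fin r → Fin d → ℤ}
    (h : IsMultipleMirror (Δ 0) (Δ 1) n) (i : Fin 2) (t : Torus Δ) : BaseVariety Δ i :=
  (Quotient.mk (homogSetoid _) (torusCoord h i t.1), t.2)

/-- `S i`: the points of `T` lying over `Z i`. -/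
def S {d r : ℕ} {Δ : Fin 2 → Fin r → Set (Fin d → ℝ)} {n : Fin r → Fin d → ℤ}
    (h : IsMultipleMirror (Δ 0) (Δ 1) n) (i : Fin 2) : Set (Torus Δ) :=
  {t | proj h i t ∈ Z Δ n i}

/-- `R i`: the points of `S i` at which the matrix `(W)` has rank `r - β`. -/
def R {d r : ℕ} {Δ : Fin 2 → Fin r → Set (Fin d → ℝ)} {n : Fin r → Fin d → ℤ}
    (h : IsMultipleMirror (Δ 0) (Δ 1) n) (i : Fin 2) : Set (Torus Δ) :=
  {t | t ∈ S h i ∧ (wMatrix Δ n t).rank + beta Δ n = r}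

/-- `Ω i`: the image of `R 0 ∩ R 1` under the projection to `Y i`; it is contained in `Z i`. -/
def Omega {d r : ℕ} {Δ : Fin 2 → Fin r → Set (Fin d → ℝ)} {n : Fin r → Fin d → ℤ}
    (h : IsMultipleMirror (Δ 0) (Δ 1) n) (i : Fin 2) : Set (BaseVariety Δ i) :=
  proj h i '' (R h 0 ∩ R h 1)

end NefMirror

end

open scoped Pointwise

namespace NefMirror

/-! Every character `χ` of `Xi` lies in exactly one `Lam Δ n 0 a` and exactly one `Lam Δ n 1 b`
(`IsMultipleMirror.existsUnique_Lam`), so `Xi` is the edge set of a finite directed multigraph whose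
underlying digraph is `D`. Over the unit of the character torus, `(W)` is the matrix of total edge
weights, and the equations of the two complete intersections hold once its row sums and its column
sums vanish (`one_mem_S`). It therefore suffices to find nonzero edge weights with vanishing row and
column sums and rank `r - β`; one such point maps to both sets `Omega`.

Such weights come from a circulation that is positive on every arrow of `D`: subtracting the total
outflow on the diagonal gives a balanced Laplacian, whose kernel consists of the functions constant
on components (`rank_add_card_connectedComponent`). The circulation exists because every arrow lies
on a directed cycle (`IsMultipleMirror.reflTransGen_of_adj`); a set of vertices closed under arrows
but entered by one from outside would give a nonzero lattice vector of constant sign on the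
reflexive polytope. A prescribed entry of the Laplacian is a sum of nonzero weights unless it is
zero and has just one edge to carry it. The latter cannot happen, since each `Δ 0 a` contains a
nonzero lattice point besides the origin.

The unique second index `b` of a character rests on the duality of nef-partitions
(`IsNefPartition.mem_of_borisovDual`). -/

theorem exists_eq_single_of_sum_eq_one {ι : Type*} [Fintype ι] [DecidableEq ι] {a : ι → ℤ}
    (h0 : ∀ k, 0 ≤ a k) (h1 : ∑ k, a k = 1) : ∃ j, a = Pi.single j 1 := by
  obtain ⟨j, hj⟩ : ∃ j, 0 < a j := by
    by_contra! hcon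
    have : ∑ k, a k ≤ 0 := Finset.sum_nonpos fun k _ => hcon k
    omega
  have hsum := Finset.add_sum_erase Finset.univ a (Finset.mem_univ j)
  have hrest : 0 ≤ ∑ k ∈ Finset.univ.erase j, a k := Finset.sum_nonneg fun k _ => h0 k
  have hz : ∑ k ∈ Finset.univ.erase j, a k = 0 := by omega
  refine ⟨j, funext fun k => ?_⟩
  by_cases hk : k = j
  · subst hk
    rw [Pi.single_eq_same]
    omega
  · rw [Pi.single_eq_of_ne hk]
    exact (Finset.sum_eq_zero_iff_of_nonneg fun k _ => h0 k).1 hz k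
      (Finset.mem_erase.2 ⟨hk, Finset.mem_univ k⟩)

/-! ### Integral polytopes and the duality of nef-partitions. -/

section Polytopes

variable {d r : ℕ}

theorem toReal_dotProduct (m v : Fin d → ℤ) : toReal m ⬝ᵥ toReal v = ((m ⬝ᵥ v : ℤ) : ℝ) := by
  simp [toReal, dotProduct]

theorem toReal_zero : toReal (0 : Fin d → ℤ) = 0 := by
  funext j
  simp [toReal]

theorem toReal_injective : Function.Injective (toReal : (Fin d → ℤ) → Fin d → ℝ) := by
  intro a b h
  funext j
  have := congrFun h j
  simpa [toReal] using this

theorem convex_le_dotProduct (v : Fin d → ℝ) (α : ℝ) : Convex ℝ {x : Fin d → ℝ | α ≤ x ⬝ᵥ v} :=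
  convex_halfSpace_ge ⟨fun x y => add_dotProduct x y v, fun c x => smul_dotProduct c x v⟩ α

theorem IsIntegralPolytope.convex {P : Set (Fin d → ℝ)} (hP : IsIntegralPolytope P) :
    Convex ℝ P := by
  obtain ⟨A, rfl⟩ := hP
  exact convex_convexHull ℝ _

theorem IsIntegralPolytope.isCompact {P : Set (Fin d → ℝ)} (hP : IsIntegralPolytope P) :
    IsCompact P := by
  obtain ⟨A, rfl⟩ := hP
  exact (A.finite_toSet.image toReal).isCompact_convexHull ℝ

theorem IsIntegralPolytope.le_dotProduct {P : Set (Fin d → ℝ)} (hP : IsIntegralPolytope P)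
    {v : Fin d → ℝ} {α : ℝ} (h : ∀ m : Fin d → ℤ, toReal m ∈ P → α ≤ toReal m ⬝ᵥ v)
    {x : Fin d → ℝ} (hx : x ∈ P) : α ≤ x ⬝ᵥ v := by
  obtain ⟨A, rfl⟩ := hP
  refine convexHull_min ?_ (convex_le_dotProduct v α) hx
  rintro _ ⟨m, hm, rfl⟩
  exact h m (subset_convexHull ℝ _ ⟨m, hm, rfl⟩)

theorem IsIntegralPolytope.exists_min {P : Set (Fin d → ℝ)} (hP : IsIntegralPolytope P)
    (hne : P.Nonempty) (v : Fin d → ℝ) :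
    ∃ m : Fin d → ℤ, toReal m ∈ P ∧ ∀ x ∈ P, toReal m ⬝ᵥ v ≤ x ⬝ᵥ v := by
  obtain ⟨A, rfl⟩ := hP
  have hA : A.Nonempty := by
    rw [convexHull_nonempty_iff, Set.image_nonempty] at hne
    exact hne
  obtain ⟨m, hm, hmin⟩ := A.exists_min_image (fun m => toReal m ⬝ᵥ v) hA
  refine ⟨m, subset_convexHull ℝ _ ⟨m, hm, rfl⟩, fun x hx => ?_⟩
  refine convexHull_min ?_ (convex_le_dotProduct v _) hx
  rintro _ ⟨m', hm', rfl⟩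
  exact hmin m' hm'

theorem IsIntegralPolytope.finite_latticePoints {P : Set (Fin d → ℝ)}
    (hP : IsIntegralPolytope P) : {m : Fin d → ℤ | toReal m ∈ P}.Finite := by
  obtain ⟨B, hB⟩ := hP.isCompact.isBounded.exists_norm_le
  refine (Set.finite_Icc (fun _ => -⌈B⌉ : Fin d → ℤ) (fun _ => ⌈B⌉)).subset fun m hm => ?_
  have h (j : Fin d) : |(m j : ℝ)| ≤ (⌈B⌉ : ℝ) :=
    ((norm_le_pi_norm (toReal m) j).trans (hB _ hm)).trans (Int.le_ceil B)
  have h' (j : Fin d) : |m j| ≤ ⌈B⌉ := by exact_mod_cast h j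
  exact ⟨fun j => (abs_le.1 (h' j)).1, fun j => (abs_le.1 (h' j)).2⟩

/-- The polar dual would contain the whole ray spanned by `u`, yet it is a polytope and hence
bounded. In effect, the origin is interior to a reflexive polytope. -/
theorem IsReflexive.eq_zero_of_nonneg {P : Set (Fin d → ℝ)} (hP : IsReflexive P)
    {u : Fin d → ℝ} (hu : ∀ p ∈ P, 0 ≤ p ⬝ᵥ u) : u = 0 := by
  have hmem (t : ℝ) (ht : 0 ≤ t) : t • u ∈ polarDual P := fun p hp => by
    rw [smul_dotProduct, dotProduct_comm, smul_eq_mul]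
    have := mul_nonneg ht (hu p hp)
    linarith
  obtain ⟨w, -, hw⟩ := hP.2.exists_min ⟨_, hmem 0 le_rfl⟩ (-u)
  by_contra hne
  have hpos : 0 < u ⬝ᵥ u := by
    refine lt_of_le_of_ne (Finset.sum_nonneg fun j _ => mul_self_nonneg _) fun h => hne ?_
    exact dotProduct_self_eq_zero.1 h.symm
  have ht : 0 ≤ (|toReal w ⬝ᵥ u| + 1) / (u ⬝ᵥ u) := by positivity
  have h1 := hw _ (hmem _ ht)
  rw [dotProduct_neg, dotProduct_neg, smul_dotProduct, smul_eq_mul,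
    div_mul_cancel₀ _ hpos.ne'] at h1
  linarith [le_abs_self (toReal w ⬝ᵥ u)]

theorem IsNefPartition.sum_mem {Δ : Fin r → Set (Fin d → ℝ)} {p : Fin r → Fin d → ℝ}
    (hp : ∀ k, p k ∈ Δ k) : ∑ k, p k ∈ ∑ k, Δ k :=
  Set.finsetSum_mem_finsetSum _ _ _ fun k _ => hp k

/-- A lattice point of the polar dual of the Minkowski sum, at which the summands `p k` of a point
of that sum attain `-1`, is in one of the members of the Borisov dual. -/
theorem IsNefPartition.exists_mem_borisovDual {Δ : Fin r → Set (Fin d → ℝ)}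
    (hΔ : IsNefPartition Δ) {p : Fin r → Fin d → ℤ} (hp : ∀ k, toReal (p k) ∈ Δ k)
    {u : Fin d → ℤ} (hu : toReal u ∈ polarDual (∑ k, Δ k)) (hpu : ∑ k, p k ⬝ᵥ u = -1) :
    ∃ j, toReal u ∈ borisovDual Δ j ∧ ∀ k, p k ⬝ᵥ u = -(if k = j then 1 else 0) := by
  have hmin (k : Fin r) (q : Fin d → ℝ) (hq : q ∈ Δ k) :
      ((p k ⬝ᵥ u : ℤ) : ℝ) ≤ q ⬝ᵥ toReal u := by
    -- Exchanging the single summand `p k` for `q` stays in the Minkowski sum and cannot bring the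
    -- pairing below its minimum `-1`.
    have hmem : ∑ l, Function.update (fun l => toReal (p l)) k q l ∈ ∑ l, Δ l := by
      refine IsNefPartition.sum_mem fun l => ?_
      by_cases hl : l = k
      · subst hl
        simpa using hq
      · simpa [hl] using hp l
    have h1 := hu _ hmem
    rw [Finset.sum_update_of_mem (Finset.mem_univ k), dotProduct_comm, add_dotProduct,
      sum_dotProduct] at h1
    simp only [toReal_dotProduct] at h1
    rw [← Finset.add_sum_erase Finset.univ _ (Finset.mem_univ k)] at hpu
    have hpu' := congrArg (Int.cast : ℤ → ℝ) hpu
    push_cast at hpu'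
    rw [Finset.sdiff_singleton_eq_erase] at h1
    linarith
  obtain ⟨j, hj⟩ := exists_eq_single_of_sum_eq_one (a := fun k => -(p k ⬝ᵥ u))
    (fun k => by
      have := hmin k 0 (hΔ.zero_mem k)
      rw [zero_dotProduct] at this
      have h2 : p k ⬝ᵥ u ≤ 0 := by exact_mod_cast this
      omega)
    (by rw [Finset.sum_neg_distrib, hpu]; rfl)
  have hval (k : Fin r) : p k ⬝ᵥ u = -(if k = j then 1 else 0) := by
    have := congrFun hj k
    rw [Pi.single_apply] at this
    rw [← this, neg_neg]
  refine ⟨j, fun k m hm => ?_, hval⟩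
  have := hmin k m hm
  rw [hval k] at this
  push_cast at this
  linarith

/-- The nontrivial half of the duality of nef-partitions: the members of a nef-partition are cut out
by its Borisov dual. -/
theorem IsNefPartition.mem_of_borisovDual {Δ : Fin r → Set (Fin d → ℝ)}
    (hΔ : IsNefPartition Δ) {b : Fin r} {x : Fin d → ℝ}
    (hx : ∀ k, ∀ v ∈ borisovDual Δ k, 0 ≤ x ⬝ᵥ v + (if k = b then 1 else 0)) : x ∈ Δ b := by
  by_contra hxb
  obtain ⟨f, α, hfx, hfα⟩ := geometric_hahn_banach_point_closed (hΔ.polytope b).convex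
    (hΔ.polytope b).isCompact.isClosed hxb
  obtain ⟨v, hv⟩ : ∃ v : Fin d → ℝ, ∀ y, f y = y ⬝ᵥ v := by
    refine ⟨fun j => f (Pi.single j 1), fun y => ?_⟩
    conv_lhs => rw [pi_eq_sum_univ' y]
    simp only [map_sum, map_smul, smul_eq_mul]
    rfl
  have hsep (y : Fin d → ℝ) (hy : y ∈ Δ b) : x ⬝ᵥ v < y ⬝ᵥ v := by
    rw [← hv, ← hv]
    exact hfx.trans (hfα y hy)
  choose p hp hpmin using fun k => (hΔ.polytope k).exists_min ⟨0, hΔ.zero_mem k⟩ v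
  set P : Fin d → ℝ := ∑ k, toReal (p k) with hPdef
  have hPmin : ∀ q ∈ ∑ k, Δ k, P ⬝ᵥ v ≤ q ⬝ᵥ v := by
    intro q hq
    obtain ⟨g, hg, rfl⟩ := (Set.mem_fintype_sum _ _).1 hq
    rw [hPdef, sum_dotProduct, sum_dotProduct]
    exact Finset.sum_le_sum fun k _ => hpmin k _ (hg k)
  have hφ : P ⬝ᵥ v < 0 := by
    by_contra! hcon
    have hv0 : v = 0 := hΔ.reflexive.eq_zero_of_nonneg fun q hq => hcon.trans (hPmin q hq)
    have := hsep 0 (hΔ.zero_mem b)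
    rw [hv0, dotProduct_zero, dotProduct_zero] at this
    exact lt_irrefl _ this
  -- Normalised by `φ`, the separating functional lands on the face of the polar dual where the
  -- pairing with `P` is `-1`.
  set φ : ℝ := -(P ⬝ᵥ v) with hφdef
  have hφpos : 0 < φ := by linarith
  have hvmem : φ⁻¹ • v ∈ polarDual (∑ k, Δ k) := by
    intro q hq
    rw [smul_dotProduct, dotProduct_comm, smul_eq_mul]
    have h1 : -φ ≤ q ⬝ᵥ v := by linarith [hPmin q hq]
    calc (-1 : ℝ) = φ⁻¹ * (-φ) := by field_simp
      _ ≤ φ⁻¹ * (q ⬝ᵥ v) := by gcongr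
  obtain ⟨A, hA⟩ := hΔ.reflexive.2
  -- By integrality a generator `u` of the polar dual pairs with `P` to `-1` or to at least `0`. In
  -- the first case `u` lies in some member of the Borisov dual and `u ⬝ᵥ y ≥ 0`; in the second, `K`
  -- bounds the possible negativity. The resulting bound `key`, taken at `φ⁻¹ • v`, yields `y ⬝ᵥ v ≥
  -- 0`, against the separation.
  set y : Fin d → ℝ := x - toReal (p b) with hy
  set K : ℝ := ∑ u ∈ A, |toReal u ⬝ᵥ y| with hK
  have hK0 : 0 ≤ K := Finset.sum_nonneg fun u _ => abs_nonneg _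
  have key : ∀ w ∈ polarDual (∑ k, Δ k), -K ≤ w ⬝ᵥ (y + K • P) := by
    intro w hw
    rw [hA] at hw
    refine convexHull_min ?_ (convex_le_dotProduct (y + K • P) (-K)) hw
    rintro _ ⟨u, hu, rfl⟩
    have hudual : toReal u ∈ polarDual (∑ k, Δ k) := hA ▸ subset_convexHull ℝ _ ⟨u, hu, rfl⟩
    have hPu : toReal u ⬝ᵥ P = ((∑ k, p k ⬝ᵥ u : ℤ) : ℝ) := by
      rw [dotProduct_comm, hPdef, sum_dotProduct]
      simp only [toReal_dotProduct, Int.cast_sum]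
    have hge : (-1 : ℤ) ≤ ∑ k, p k ⬝ᵥ u := by
      have := hudual P (IsNefPartition.sum_mem hp)
      rw [hPu] at this
      exact_mod_cast this
    change -K ≤ toReal u ⬝ᵥ (y + K • P)
    rw [dotProduct_add, dotProduct_smul, smul_eq_mul, hPu]
    rcases hge.eq_or_lt with heq | hlt
    · obtain ⟨j, hj, hval⟩ := hΔ.exists_mem_borisovDual hp hudual heq.symm
      have h1 := hx j _ hj
      have h2 : toReal (p b) ⬝ᵥ toReal u = -(if b = j then 1 else 0) := by
        rw [toReal_dotProduct, hval b]
        push_cast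
        rfl
      rw [← heq, dotProduct_comm, hy, sub_dotProduct, h2]
      push_cast
      simp only [eq_comm (a := b)]
      linarith
    · have h0 : (0 : ℝ) ≤ ((∑ k, p k ⬝ᵥ u : ℤ) : ℝ) := by exact_mod_cast (by omega : (0:ℤ) ≤ _)
      have h1 : |toReal u ⬝ᵥ y| ≤ K :=
        Finset.single_le_sum (f := fun u => |toReal u ⬝ᵥ y|) (fun u _ => abs_nonneg _) hu
      have h2 := neg_abs_le (toReal u ⬝ᵥ y)
      have h3 := mul_nonneg hK0 h0
      linarith
  have h1 := key _ hvmem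
  rw [dotProduct_add, dotProduct_smul, smul_eq_mul, smul_dotProduct, smul_dotProduct,
    dotProduct_comm v P, dotProduct_comm v y, smul_eq_mul, smul_eq_mul] at h1
  have h2 : φ⁻¹ * (P ⬝ᵥ v) = -1 := by
    rw [show P ⬝ᵥ v = -φ by linarith]
    field_simp
  have h3 : y ⬝ᵥ v < 0 := by
    rw [hy, sub_dotProduct]
    linarith [hsep _ (hp b)]
  have h4 : φ⁻¹ * (y ⬝ᵥ v) < 0 := mul_neg_of_pos_of_neg (inv_pos.2 hφpos) h3
  rw [h2] at h1
  linarith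

end Polytopes

/-! ### Circulations, balanced Laplacians and their rank. -/

section Circulations

variable {V : Type*} [Fintype V] [DecidableEq V]

/-- A unit flow along a path. -/
theorem exists_flow_of_reflTransGen {D : V → V → Prop} {b a : V}
    (h : Relation.ReflTransGen D b a) :
    ∃ f : V → V → ℝ, (∀ x y, 0 ≤ f x y) ∧ (∀ x y, ¬ D x y → f x y = 0) ∧
      ∀ x, ∑ y, f x y - ∑ y, f y x = (if x = b then 1 else 0) - (if x = a then 1 else 0) := by
  induction h with
  | refl => exact ⟨fun _ _ => 0, by simp, by simp, by simp⟩
  | @tail c e _ hce ih =>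
    obtain ⟨f, h0, hs, hf⟩ := ih
    refine ⟨fun x y => f x y + (if x = c then 1 else 0) * (if y = e then 1 else 0), ?_, ?_, ?_⟩
    · intro x y
      have := h0 x y
      positivity
    · intro x y hxy
      simp only [hs x y hxy, zero_add]
      by_cases hx : x = c <;> by_cases hy : y = e <;> simp_all
    · intro x
      have := hf x
      simp only [Finset.sum_add_distrib, ← Finset.mul_sum, ← Finset.sum_mul, Finset.sum_ite_eq',
        Finset.mem_univ, if_true]
      linarith

/-- Each arrow is closed up by a unit flow along a path back to its source; the sum of these
circulations over all arrows is positive on each of them. -/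
theorem exists_circulation {D : V → V → Prop} (hD : ∀ a b, D a b → Relation.ReflTransGen D b a) :
    ∃ f : V → V → ℝ, (∀ x y, 0 ≤ f x y) ∧ (∀ x y, ¬ D x y → f x y = 0) ∧
      (∀ x y, D x y → 0 < f x y) ∧ ∀ x, ∑ y, f x y = ∑ y, f y x := by
  classical
  have h (e : V × V) : ∃ f : V → V → ℝ, (∀ x y, 0 ≤ f x y) ∧ (∀ x y, ¬ D x y → f x y = 0) ∧
      (D e.1 e.2 → 0 < f e.1 e.2) ∧ ∀ x, ∑ y, f x y = ∑ y, f y x := by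
    by_cases he : D e.1 e.2
    · obtain ⟨f, h0, hs, hf⟩ := exists_flow_of_reflTransGen (hD _ _ he)
      refine ⟨fun x y => f x y + (if x = e.1 then 1 else 0) * (if y = e.2 then 1 else 0),
        ?_, ?_, ?_, ?_⟩
      · intro x y
        have := h0 x y
        positivity
      · intro x y hxy
        simp only [hs x y hxy, zero_add]
        by_cases hx : x = e.1 <;> by_cases hy : y = e.2 <;> simp_all
      · intro _
        have := h0 e.1 e.2
        simp only [if_true]
        linarith
      · intro x
        have := hf x
        simp only [Finset.sum_add_distrib, ← Finset.mul_sum, ← Finset.sum_mul, Finset.sum_ite_eq',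
          Finset.mem_univ, if_true]
        linarith
    · exact ⟨fun _ _ => 0, by simp, by simp, fun h => absurd h he, by simp⟩
  choose F h0 hs hpos hbal using h
  refine ⟨fun x y => ∑ e, F e x y, fun x y => Finset.sum_nonneg fun e _ => h0 e x y,
    fun x y hxy => Finset.sum_eq_zero fun e _ => hs e x y hxy, fun x y hxy => ?_, fun x => ?_⟩
  · exact Finset.sum_pos' (fun e _ => h0 e x y) ⟨(x, y), Finset.mem_univ _, hpos (x, y) hxy⟩
  · rw [Finset.sum_comm, Finset.sum_comm (f := fun y e => F e y x)]
    exact Finset.sum_congr rfl fun e _ => hbal e x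

/-- A balanced weighted Laplacian. -/
theorem exists_balanced_matrix {D : V → V → Prop}
    (hD : ∀ a b, D a b → Relation.ReflTransGen D b a) :
    ∃ W : Matrix V V ℝ, (∀ a b, a ≠ b → D a b → 0 < W a b) ∧
      (∀ a b, a ≠ b → ¬ D a b → W a b = 0) ∧ (∀ a, (∃ b, b ≠ a ∧ D a b) → W a a ≠ 0) ∧
      (∀ a, ∑ b, W a b = 0) ∧ ∀ b, ∑ a, W a b = 0 := by
  obtain ⟨f, h0, hs, hpos, hbal⟩ := exists_circulation hD
  -- The matrix is the circulation minus the diagonal of outflows. Loops cancel, so a diagonal entry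
  -- is minus the outflow to other vertices.
  have hoff (a b : V) (hab : a ≠ b) :
      f a b - (if a = b then 1 else 0) * ∑ y, f a y = f a b := by simp [hab]
  refine ⟨Matrix.of fun a b => f a b - (if a = b then 1 else 0) * ∑ y, f a y, ?_, ?_, ?_, ?_, ?_⟩
  · intro a b hab h
    rw [Matrix.of_apply, hoff a b hab]
    exact hpos a b h
  · intro a b hab h
    rw [Matrix.of_apply, hoff a b hab]
    exact hs a b h
  · rintro a ⟨b, hba, hab⟩
    rw [Matrix.of_apply, if_pos rfl, one_mul,
      ← Finset.add_sum_erase Finset.univ _ (Finset.mem_univ a)]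
    have : f a b ≤ ∑ y ∈ Finset.univ.erase a, f a y :=
      Finset.single_le_sum (f := fun y => f a y) (fun y _ => h0 a y)
        (Finset.mem_erase.2 ⟨hba, Finset.mem_univ b⟩)
    have := hpos a b hab
    exact ne_of_lt (by linarith)
  · intro a
    simp only [Matrix.of_apply, Finset.sum_sub_distrib, ← Finset.sum_mul, Finset.sum_ite_eq,
      Finset.mem_univ, if_true]
    ring
  · intro b
    simp only [Matrix.of_apply, Finset.sum_sub_distrib, ite_mul, one_mul, zero_mul,
      Finset.sum_ite_eq', Finset.mem_univ, if_true]
    rw [hbal b]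
    ring

/-- With vanishing row and column sums, `∑ W a b * (x a - x b) ^ 2` equals `-2 xᵀWx`, which is zero
on the kernel, while each of its terms is nonnegative. No symmetry of `W` is needed. -/
theorem apply_eq_of_mulVec_eq_zero {W : Matrix V V ℝ} (h0 : ∀ a b, a ≠ b → 0 ≤ W a b)
    (hrow : ∀ a, ∑ b, W a b = 0) (hcol : ∀ b, ∑ a, W a b = 0) {x : V → ℝ}
    (hx : W.mulVec x = 0) {a b : V} (hab : 0 < W a b) : x a = x b := by
  have h1 : ∑ a, ∑ b, W a b * (x a - x b) ^ 2 = 0 := by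
    have e (a b : V) : W a b * (x a - x b) ^ 2 =
        W a b * x a ^ 2 + W a b * x b ^ 2 - 2 * (x a * (W a b * x b)) := by ring
    have e1 : ∑ a, ∑ b, W a b * x a ^ 2 = 0 :=
      Finset.sum_eq_zero fun a _ => by rw [← Finset.sum_mul, hrow, zero_mul]
    have e2 : ∑ a, ∑ b, W a b * x b ^ 2 = 0 := by
      rw [Finset.sum_comm]
      exact Finset.sum_eq_zero fun a _ => by rw [← Finset.sum_mul, hcol, zero_mul]
    have e3 : ∑ a, ∑ b, 2 * (x a * (W a b * x b)) = 0 :=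
      Finset.sum_eq_zero fun a _ => by
        rw [← Finset.mul_sum, ← Finset.mul_sum]
        have : ∑ b, W a b * x b = 0 := congrFun hx a
        rw [this, mul_zero, mul_zero]
    simp only [e, Finset.sum_sub_distrib, Finset.sum_add_distrib, e1, e2, e3]
    ring
  have hnn (a b : V) : 0 ≤ W a b * (x a - x b) ^ 2 := by
    by_cases h : a = b
    · simp [h]
    · exact mul_nonneg (h0 a b h) (sq_nonneg _)
  have h2 := (Finset.sum_eq_zero_iff_of_nonneg
    (fun a _ => Finset.sum_nonneg fun b _ => hnn a b)).1 h1 a (Finset.mem_univ a)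
  have h3 := (Finset.sum_eq_zero_iff_of_nonneg (fun b _ => hnn a b)).1 h2 b (Finset.mem_univ b)
  rcases mul_eq_zero.1 h3 with h | h
  · exact absurd h hab.ne'
  · exact sub_eq_zero.1 (pow_eq_zero_iff two_ne_zero |>.1 h)

/-- The complex kernel is the space of functions constant on components: real and imaginary parts of
a kernel vector lie in the kernel of the real matrix, where the quadratic form argument applies. -/
theorem rank_add_card_connectedComponent {W : Matrix V V ℝ} {G : SimpleGraph V}
    (h0 : ∀ a b, a ≠ b → 0 ≤ W a b) (hrow : ∀ a, ∑ b, W a b = 0) (hcol : ∀ b, ∑ a, W a b = 0)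
    (hpos : ∀ a b, G.Adj a b → 0 < W a b ∨ 0 < W b a)
    (hzero : ∀ a b, a ≠ b → ¬ G.Adj a b → W a b = 0) :
    (W.map (fun x => (x : ℂ))).rank + Nat.card G.ConnectedComponent = Fintype.card V := by
  classical
  have : Fintype G.ConnectedComponent := Fintype.ofFinite _
  have hker : LinearMap.ker (W.map (fun x => (x : ℂ))).mulVecLin =
      LinearMap.range (LinearMap.funLeft ℂ ℂ G.connectedComponentMk) := by
    ext x
    rw [LinearMap.mem_ker, LinearMap.mem_range, Matrix.mulVecLin_apply]
    constructor
    · intro hx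
      have hre : W.mulVec (fun a => (x a).re) = 0 := by
        funext a
        have := congrArg Complex.re (congrFun hx a)
        simpa [Matrix.mulVec, dotProduct] using this
      have him : W.mulVec (fun a => (x a).im) = 0 := by
        funext a
        have := congrArg Complex.im (congrFun hx a)
        simpa [Matrix.mulVec, dotProduct] using this
      have hW {a b : V} (hab : 0 < W a b) : x a = x b :=
        Complex.ext (apply_eq_of_mulVec_eq_zero h0 hrow hcol hre hab)
          (apply_eq_of_mulVec_eq_zero h0 hrow hcol him hab)
      have hadj {a b : V} (hab : G.Adj a b) : x a = x b :=
        (hpos a b hab).elim hW fun h => (hW h).symm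
      have hwalk {a b : V} (w : G.Walk a b) : x a = x b := by
        induction w with
        | nil => rfl
        | cons h _ ih => exact (hadj h).trans ih
      refine ⟨fun c => c.lift x fun _ _ w _ => hwalk w, ?_⟩
      funext a
      rfl
    · rintro ⟨z, rfl⟩
      funext a
      change ∑ b, (W a b : ℂ) * z (G.connectedComponentMk b) = 0
      have e (b : V) : (W a b : ℂ) * z (G.connectedComponentMk b) =
          (W a b : ℂ) * z (G.connectedComponentMk a) := by
        by_cases hab : a = b
        · rw [hab]
        · by_cases h : G.Adj a b
          · rw [SimpleGraph.ConnectedComponent.connectedComponentMk_eq_of_adj h]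
          · rw [hzero a b hab h, Complex.ofReal_zero, zero_mul, zero_mul]
      rw [Finset.sum_congr rfl fun b _ => e b, ← Finset.sum_mul, ← Complex.ofReal_sum, hrow,
        Complex.ofReal_zero, zero_mul]
  have h1 := LinearMap.finrank_range_add_finrank_ker (W.map (fun x => (x : ℂ))).mulVecLin
  rw [hker, LinearMap.finrank_range_of_inj (LinearMap.funLeft_injective_of_surjective ℂ ℂ _
    fun c => c.exists_rep), Module.finrank_fintype_fun_eq_card, Module.finrank_fintype_fun_eq_card]
    at h1
  rw [Nat.card_eq_fintype_card]
  exact h1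

/-- A nonzero sum is shared out equally; for the sum zero, one term balances all the others, each
equal to `1`. -/
theorem exists_units_sum_eq {F : Type*} [DecidableEq F] (A : Finset F) (hA : A.Nonempty) (w : ℂ)
    (hw : w ≠ 0 ∨ ∃ x ∈ A, ∃ y ∈ A, x ≠ y) : ∃ c : F → ℂˣ, ∑ x ∈ A, (c x : ℂ) = w := by
  have hcard : (A.card : ℂ) ≠ 0 := Nat.cast_ne_zero.2 hA.card_pos.ne'
  by_cases h0 : w = 0
  · obtain ⟨x, hx, y, hy, hxy⟩ := hw.resolve_left (not_not.2 h0)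
    have hne : (-((A.erase x).card : ℂ)) ≠ 0 :=
      neg_ne_zero.2 (Nat.cast_ne_zero.2
        (Finset.card_pos.2 ⟨y, Finset.mem_erase.2 ⟨hxy.symm, hy⟩⟩).ne')
    refine ⟨fun z => if z = x then Units.mk0 _ hne else 1, ?_⟩
    rw [← Finset.add_sum_erase A _ hx, Finset.sum_congr rfl
      (g := fun _ => (1 : ℂ)) fun z hz => by simp [Finset.ne_of_mem_erase hz]]
    simp [h0]
  · refine ⟨fun _ => Units.mk0 (w / A.card) (div_ne_zero h0 hcard), ?_⟩
    rw [Finset.sum_const, Units.val_mk0, nsmul_eq_mul, mul_div_cancel₀ _ hcard]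

/-- Nonzero coefficients on the edges of a directed multigraph in which every edge lies on a cycle,
for which the weighted adjacency matrix has vanishing row and column sums and maximal rank. -/
theorem exists_balanced_coefficients {X : Type*} [Fintype X] (f g : X → V)
    (hcyc : ∀ x, Relation.ReflTransGen (fun a b => ∃ z, f z = a ∧ g z = b) (g x) (f x))
    (hloop : ∀ a, ∃ x, f x = a ∧ g x = a) (htwo : ∀ a, ∃ x y, x ≠ y ∧ f x = a ∧ f y = a)
    {G : SimpleGraph V}
    (hG : ∀ a b, G.Adj a b ↔
      a ≠ b ∧ ((∃ z, f z = a ∧ g z = b) ∨ ∃ z, f z = b ∧ g z = a)) :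
    ∃ (c : X → ℂˣ) (W : Matrix V V ℂ),
      (∀ a b, ∑ᶠ x : {x // f x = a ∧ g x = b}, (c x : ℂ) = W a b) ∧
      (∀ a, ∑ᶠ x : {x // f x = a}, (c x : ℂ) = 0) ∧
      (∀ b, ∑ᶠ x : {x // g x = b}, (c x : ℂ) = 0) ∧
      W.rank + Nat.card G.ConnectedComponent = Fintype.card V := by
  classical
  set D : V → V → Prop := fun a b => ∃ z, f z = a ∧ g z = b with hDdef
  obtain ⟨W, hpos, hzero, hdiag, hrow, hcol⟩ := exists_balanced_matrix (D := D) (by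
    rintro a b ⟨x, rfl, rfl⟩
    exact hcyc x)
  -- The edges from `a` to `b` for different pairs are disjoint, so weights can be chosen separately
  -- for each entry.
  have hc (a b : V) : ∃ c : X → ℂˣ,
      ∑ x ∈ Finset.univ.filter (fun x => f x = a ∧ g x = b), (c x : ℂ) = W a b := by
    by_cases hab : D a b
    · obtain ⟨z, hz⟩ := hab
      refine exists_units_sum_eq _ ⟨z, by simpa using hz⟩ _ ?_
      by_cases hne : a = b
      · subst hne
        by_cases hout : ∃ e, e ≠ a ∧ D a e
        · exact Or.inl (Complex.ofReal_ne_zero.2 (hdiag a hout))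
        -- No arrow leaves `a` for another vertex, so the diagonal entry may vanish; but then both
        -- edges out of `a` are loops, enough to realise the sum zero.
        · obtain ⟨x, y, hxy, hx, hy⟩ := htwo a
          have hg (x : X) (hx : f x = a) : g x = a := by
            by_contra hcon
            exact hout ⟨g x, hcon, x, hx, rfl⟩
          exact Or.inr ⟨x, by simp [hx, hg x hx], y, by simp [hy, hg y hy], hxy⟩
      · exact Or.inl (Complex.ofReal_ne_zero.2 (hpos a b hne ⟨z, hz⟩).ne')
    · refine ⟨fun _ => 1, ?_⟩
      have hab' : a ≠ b := by
        rintro rfl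
        exact hab (hloop a)
      rw [hzero a b hab' hab, Finset.filter_eq_empty_iff.2 fun {x} _ hx => hab ⟨x, hx⟩]
      simp
  choose c hc using hc
  have hsum (a b : V) :
      ∑ x ∈ Finset.univ.filter (fun x => f x = a ∧ g x = b), (c (f x) (g x) x : ℂ) = W a b := by
    rw [← hc a b]
    refine Finset.sum_congr rfl fun x hx => ?_
    obtain ⟨h1, h2⟩ := (Finset.mem_filter.1 hx).2
    rw [h1, h2]
  have hfin (p : X → Prop) [DecidablePred p] : ∑ᶠ x : {x // p x}, (c (f x) (g x) x : ℂ) =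
      ∑ x ∈ Finset.univ.filter p, (c (f x) (g x) x : ℂ) := by
    rw [finsum_eq_sum_of_fintype]
    exact (Finset.sum_subtype _ (by simp) (fun x => (c (f x) (g x) x : ℂ))).symm
  refine ⟨fun x => c (f x) (g x) x, W.map (fun x => (x : ℂ)), fun a b => ?_, fun a => ?_,
    fun b => ?_, ?_⟩
  · rw [hfin fun x => f x = a ∧ g x = b, hsum]
    rfl
  · rw [hfin fun x => f x = a, ← Finset.sum_fiberwise _ g]
    simp only [Finset.filter_filter, hsum]
    rw [← Complex.ofReal_sum, hrow, Complex.ofReal_zero]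
  · rw [hfin fun x => g x = b, ← Finset.sum_fiberwise _ f]
    simp only [Finset.filter_filter, and_comm (a := g _ = b), hsum]
    rw [← Complex.ofReal_sum, hcol, Complex.ofReal_zero]
  · have h0 (a b : V) (hab : a ≠ b) : 0 ≤ W a b := by
      by_cases h : D a b
      · exact (hpos a b hab h).le
      · exact (hzero a b hab h).ge
    refine rank_add_card_connectedComponent h0 hrow hcol (fun a b h => ?_) fun a b hab h => ?_
    · obtain ⟨hab, h | h⟩ := (hG a b).1 h
      · exact Or.inl (hpos a b hab h)
      · exact Or.inr (hpos b a hab.symm h)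
    · exact hzero a b hab fun hD => h ((hG a b).2 ⟨hab, Or.inl hD⟩)

end Circulations

/-! ### The characters of the superpotential as edges of a multigraph. -/

section Characters

variable {d r : ℕ}

theorem exists_of_mem_deltaTilde {Δ : Fin r → Set (Fin d → ℝ)} (hconv : ∀ k, Convex ℝ (Δ k))
    (hzero : ∀ k, (0 : Fin d → ℝ) ∈ Δ k) {x : Fin d → ℝ} {y : Fin r → ℤ}
    (h : (x, toReal y) ∈ deltaTilde Δ) : ∃ a, y = Pi.single a 1 ∧ x ∈ Δ a := by
  classical
  obtain ⟨ι, _, w, z, hw0, hw1, hz, hsum⟩ := mem_convexHull_iff_exists_fintype.1 h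
  choose κ hκ using fun i => Set.mem_iUnion.1 (hz i)
  choose p hp hpz using hκ
  have hx : ∑ i, w i • p i = x := by
    have := congrArg Prod.fst hsum
    rw [Prod.fst_sum] at this
    simpa [← hpz] using this
  have hy (k : Fin r) : ∑ i, (if κ i = k then w i else 0) = (y k : ℝ) := by
    have := congrFun (congrArg Prod.snd hsum) k
    rw [Prod.snd_sum, Finset.sum_apply] at this
    simpa [← hpz, Pi.single_apply, toReal, eq_comm (a := k)] using this
  obtain ⟨a, ha⟩ := exists_eq_single_of_sum_eq_one (a := y)
    (fun k => by
      have : (0 : ℝ) ≤ (y k : ℝ) := by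
        rw [← hy k]
        exact Finset.sum_nonneg fun i _ => by split_ifs <;> simp [hw0]
      exact_mod_cast this)
    (by
      have : ((∑ k, y k : ℤ) : ℝ) = 1 := by
        push_cast
        rw [← Finset.sum_congr rfl fun k _ => hy k, Finset.sum_comm]
        simpa using hw1
      exact_mod_cast this)
  refine ⟨a, ha, ?_⟩
  -- Points outside the `a`-th piece have weight zero, so they can be replaced by the origin, which
  -- lies in `Δ a`.
  have hvan (i : ι) (hi : κ i ≠ a) : w i = 0 := by
    have h1 := hy (κ i)
    rw [ha, Pi.single_eq_of_ne hi, Int.cast_zero, Finset.sum_eq_zero_iff_of_nonneg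
      fun j _ => by split_ifs <;> simp [hw0]] at h1
    simpa using h1 i (Finset.mem_univ i)
  rw [← hx]
  have : ∑ i, w i • p i = ∑ i, w i • (if κ i = a then p i else 0) :=
    Finset.sum_congr rfl fun i _ => by
      split_ifs with hi
      · rfl
      · rw [hvan i hi, zero_smul, zero_smul]
  rw [this]
  refine (hconv a).sum_mem (fun i _ => hw0 i) hw1 fun i _ => ?_
  split_ifs with hi
  · exact hi ▸ hp i
  · exact hzero a

theorem mem_Xi {Δ : Fin 2 → Fin r → Set (Fin d → ℝ)} {m : Fin d → ℤ} {a : Fin r}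
    (hm : toReal m ∈ Δ 0 a) : (m, Pi.single a 1) ∈ Xi Δ := by
  refine subset_convexHull ℝ _ (Set.mem_iUnion.2 ⟨a, toReal m, hm, ?_⟩)
  refine Prod.ext rfl (funext fun k => ?_)
  by_cases hk : k = a
  · subst hk
    simp [toReal]
  · simp [toReal, hk]

theorem charIdent_zero_apply (n : Fin r → Fin d → ℤ) (χ : Mbar d r) : charIdent n 0 χ = χ :=
  Prod.ext rfl (funext fun k => by simp [charIdent, shift])

theorem single_one_injective {ι : Type*} [DecidableEq ι] :
    Function.Injective fun a : ι => (Pi.single a 1 : ι → ℤ) := by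
  intro a b h
  have := congrFun h b
  by_contra hne
  simp [Pi.single_eq_of_ne (Ne.symm hne)] at this

theorem Lam_disjoint {Δ : Fin 2 → Fin r → Set (Fin d → ℝ)} {n : Fin r → Fin d → ℤ} {i : Fin 2}
    {a b : Fin r} {χ : Xi Δ} (ha : χ ∈ Lam Δ n i a) (hb : χ ∈ Lam Δ n i b) : a = b := by
  obtain ⟨m, -, hm⟩ := ha
  obtain ⟨m', -, hm'⟩ := hb
  rw [hm] at hm'
  have h1 : m = m' := congrArg Prod.fst hm'
  subst h1
  refine single_one_injective (funext fun k => ?_)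
  have h2 : (Pi.single a 1 : Fin r → ℤ) k + m ⬝ᵥ shift n i k =
      (Pi.single b 1 : Fin r → ℤ) k + m ⬝ᵥ shift n i k := congrFun (congrArg Prod.snd hm') k
  exact add_right_cancel h2

/-- Together with the origin this provides two distinct edges out of every vertex of the multigraph.
-/
theorem IsNefPartition.exists_ne_zero {Δ : Fin r → Set (Fin d → ℝ)} (hΔ : IsNefPartition Δ)
    (a : Fin r) : ∃ m : Fin d → ℤ, m ≠ 0 ∧ toReal m ∈ Δ a := by
  by_contra! hcon
  refine hΔ.ne_zero a (Set.eq_singleton_iff_unique_mem.2 ⟨hΔ.zero_mem a, ?_⟩)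
  obtain ⟨A, hA⟩ := hΔ.polytope a
  have hsub : Δ a ⊆ {0} := by
    conv_lhs => rw [hA]
    refine convexHull_min ?_ (convex_singleton 0)
    rintro _ ⟨m, hm, rfl⟩
    have hma : toReal m ∈ Δ a := hA ▸ subset_convexHull ℝ _ ⟨m, hm, rfl⟩
    have hm0 : m = 0 := by
      by_contra hne
      exact hcon m hne hma
    rw [hm0, toReal_zero]
    rfl
  exact fun x hx => hsub hx

/-! ### Multiple mirrors: the arrows of `D`, its cycles, and the point of `T`. -/

section Mirror

variable {Δ : Fin 2 → Fin r → Set (Fin d → ℝ)} {n : Fin r → Fin d → ℤ}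

/-- A lattice point of a member of the first nef-partition lies in a member of the second one, and
the two members are determined by its pairings with the translation vectors. -/
theorem IsMultipleMirror.exists_mem (h : IsMultipleMirror (Δ 0) (Δ 1) n) {m : Fin d → ℤ}
    {a : Fin r} (hm : toReal m ∈ Δ 0 a) :
    ∃ b, toReal m ∈ Δ 1 b ∧
      ∀ k, m ⬝ᵥ n k = (if k = a then 1 else 0) - (if k = b then 1 else 0) := by
  have hdual (k : Fin r) (v : Fin d → ℝ) (hv : v ∈ borisovDual (Δ 1) k) :
      0 ≤ toReal m ⬝ᵥ v + (((if k = a then 1 else 0) - m ⬝ᵥ n k : ℤ) : ℝ) := by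
    rw [h.dual_eq k] at hv
    obtain ⟨v', hv', rfl⟩ := hv
    have := hv' a _ hm
    rw [dotProduct_add, toReal_dotProduct]
    push_cast
    simp only [eq_comm (a := a)] at this
    linarith
  -- The integers `δ(k, a) - m ⬝ᵥ n k` are nonnegative since `0` lies in every member of the second
  -- Borisov dual, and they sum to `1` since the `n k` sum to zero.
  obtain ⟨b, hb⟩ := exists_eq_single_of_sum_eq_one
    (a := fun k => (if k = a then 1 else 0) - m ⬝ᵥ n k)
    (fun k => by
      have := hdual k 0 fun k' m' _ => by
        rw [dotProduct_zero, zero_add]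
        split_ifs <;> norm_num
      rw [dotProduct_zero, zero_add] at this
      exact_mod_cast this)
    (by
      rw [Finset.sum_sub_distrib, ← dotProduct_sum, h.sum_eq_zero, dotProduct_zero]
      simp)
  have hb' (k : Fin r) : (if k = a then 1 else 0) - m ⬝ᵥ n k = if k = b then 1 else 0 := by
    have := congrFun hb k
    rwa [Pi.single_apply] at this
  refine ⟨b, h.nef₂.mem_of_borisovDual fun k v hv => ?_, fun k => by rw [← hb' k]; ring⟩
  have := hdual k v hv
  rw [hb' k] at this
  exact_mod_cast this

/-- The pairings with the `n k` are exactly what turns `e_b` into `e_a` under `charIdent n 1`. -/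
theorem IsMultipleMirror.exists_mem_Lam (h : IsMultipleMirror (Δ 0) (Δ 1) n) {m : Fin d → ℤ}
    {a : Fin r} (hm : toReal m ∈ Δ 0 a) :
    ∃ b, (⟨(m, Pi.single a 1), mem_Xi hm⟩ : Xi Δ) ∈ Lam Δ n 0 a ∩ Lam Δ n 1 b ∧
      ∀ k, m ⬝ᵥ n k = (if k = a then 1 else 0) - (if k = b then 1 else 0) := by
  obtain ⟨b, hb, hn⟩ := h.exists_mem hm
  refine ⟨b, ⟨⟨m, hm, (charIdent_zero_apply _ _).symm⟩, ⟨m, hb, ?_⟩⟩, hn⟩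
  refine Prod.ext rfl (funext fun k => ?_)
  change (Pi.single a 1 : Fin r → ℤ) k = (Pi.single b 1 : Fin r → ℤ) k + m ⬝ᵥ n k
  rw [hn k, Pi.single_apply, Pi.single_apply]
  ring

theorem IsMultipleMirror.exists_eq (h : IsMultipleMirror (Δ 0) (Δ 1) n) (χ : Xi Δ) :
    ∃ (m : Fin d → ℤ) (a : Fin r) (hm : toReal m ∈ Δ 0 a),
      χ = ⟨(m, Pi.single a 1), mem_Xi hm⟩ := by
  obtain ⟨a, ha, hm⟩ := exists_of_mem_deltaTilde (fun k => (h.nef₁.polytope k).convex)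
    h.nef₁.zero_mem χ.2
  exact ⟨χ.1.1, a, hm, Subtype.ext (Prod.ext rfl ha)⟩

theorem IsMultipleMirror.existsUnique_Lam (h : IsMultipleMirror (Δ 0) (Δ 1) n) (i : Fin 2)
    (χ : Xi Δ) : ∃ a, ∀ b, χ ∈ Lam Δ n i b ↔ a = b := by
  obtain ⟨m, a, hm, rfl⟩ := h.exists_eq χ
  obtain ⟨b, ⟨h0, h1⟩, -⟩ := h.exists_mem_Lam hm
  fin_cases i
  · exact ⟨a, fun k => ⟨fun hk => Lam_disjoint h0 hk, fun hk => hk ▸ h0⟩⟩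
  · exact ⟨b, fun k => ⟨fun hk => Lam_disjoint h1 hk, fun hk => hk ▸ h1⟩⟩

theorem IsMultipleMirror.finite_Xi (h : IsMultipleMirror (Δ 0) (Δ 1) n) : Finite (Xi Δ) := by
  have hfin : (⋃ a : Fin r, (fun m : Fin d → ℤ => ((m, Pi.single a 1) : Mbar d r)) ''
      {m | toReal m ∈ Δ 0 a}).Finite :=
    Set.finite_iUnion fun a => (h.nef₁.polytope a).finite_latticePoints.image _
  refine (hfin.subset fun χ hχ => ?_).to_subtype
  obtain ⟨m, a, hm, hE⟩ := h.exists_eq ⟨χ, hχ⟩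
  exact Set.mem_iUnion.2 ⟨a, m, hm, (congrArg Subtype.val hE).symm⟩

/-- Every arrow of the graph `D` lies on a directed cycle. -/
theorem IsMultipleMirror.reflTransGen_of_adj (h : IsMultipleMirror (Δ 0) (Δ 1) n) {a b : Fin r}
    (hab : (dGraph Δ n).Adj a b) : Relation.ReflTransGen (dGraph Δ n).Adj b a := by
  classical
  by_contra hcon
  -- No arrow leaves the set `B` of vertices reachable from `b`. For `m` on an arrow from `c` to
  -- `e`, the vector `∑ k ∈ B, n k` pairs with `m` to `[c ∈ B] - [e ∈ B] ≤ 0`, so it is zero; but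
  -- the arrow from `a` into `B` gives `-1`.
  set B : Finset (Fin r) :=
    Finset.univ.filter fun k => Relation.ReflTransGen (dGraph Δ n).Adj b k with hB
  have hpair {m : Fin d → ℤ} {c e : Fin r}
      (hn : ∀ k, m ⬝ᵥ n k = (if k = c then 1 else 0) - (if k = e then 1 else 0)) :
      m ⬝ᵥ ∑ k ∈ B, n k = (if c ∈ B then 1 else 0) - (if e ∈ B then 1 else 0) := by
    rw [dotProduct_sum, Finset.sum_congr rfl fun k _ => hn k, Finset.sum_sub_distrib,
      Finset.sum_ite_eq', Finset.sum_ite_eq']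
  have hle (c : Fin r) (m : Fin d → ℤ) (hm : toReal m ∈ Δ 0 c) : m ⬝ᵥ ∑ k ∈ B, n k ≤ 0 := by
    obtain ⟨e, he, hn⟩ := h.exists_mem_Lam hm
    rw [hpair hn]
    have himp : c ∈ B → e ∈ B := fun hc => by
      simp only [hB, Finset.mem_filter, Finset.mem_univ, true_and] at hc ⊢
      exact hc.tail ⟨_, he⟩
    split_ifs <;> simp_all
  have hzero : -toReal (∑ k ∈ B, n k) = 0 := by
    refine h.nef₁.reflexive.eq_zero_of_nonneg fun q hq => ?_
    obtain ⟨g, hg, rfl⟩ := (Set.mem_fintype_sum _ _).1 hq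
    rw [sum_dotProduct]
    refine Finset.sum_nonneg fun k _ => (h.nef₁.polytope k).le_dotProduct (fun m hm => ?_) (hg k)
    rw [dotProduct_neg, toReal_dotProduct]
    have := hle k m hm
    have : ((m ⬝ᵥ ∑ k ∈ B, n k : ℤ) : ℝ) ≤ 0 := by exact_mod_cast this
    linarith
  have hsum : ∑ k ∈ B, n k = 0 := by
    apply toReal_injective
    rw [toReal_zero, ← neg_eq_zero, hzero]
  obtain ⟨χ, h0, h1⟩ := hab
  obtain ⟨m, c, hm, rfl⟩ := h.exists_eq χ
  obtain ⟨e, ⟨h0', h1'⟩, hn⟩ := h.exists_mem_Lam hm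
  obtain rfl := Lam_disjoint h0 h0'
  obtain rfl := Lam_disjoint h1 h1'
  have h2 := hpair hn
  have haB : a ∉ B := by simpa [hB] using hcon
  have hbB : b ∈ B := by simp [hB, Relation.ReflTransGen.refl]
  rw [hsum, dotProduct_zero, if_neg haB, if_pos hbB] at h2
  norm_num at h2

/-- Over the unit element of the torus of characters, `S i` is given by the vanishing of the sums of
the coefficients over the sets `Lam Δ n i k`. -/
theorem one_mem_S (h : IsMultipleMirror (Δ 0) (Δ 1) n) (i : Fin 2) {c : Coeff Δ}
    (hc : ∀ k, ∑ᶠ χ : Lam Δ n i k, (c χ : ℂ) = 0) : ((1, c) : Torus Δ) ∈ S h i := by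
  refine ⟨torusCoord h i 1, rfl, fun k p hp => ?_⟩
  rw [← hc k]
  -- Every monomial is `1` at the unit, so the form is the sum of coefficients whatever `p` is.
  exact finsum_congr fun χ => mul_one _

theorem exists_mem_R (h : IsMultipleMirror (Δ 0) (Δ 1) n) : ∃ t, t ∈ R h 0 ∩ R h 1 := by
  have := h.finite_Xi
  have : Fintype (Xi Δ) := Fintype.ofFinite _
  choose f hf using h.existsUnique_Lam 0
  choose g hg using h.existsUnique_Lam 1
  have hadj (a b : Fin r) : (dGraph Δ n).Adj a b ↔ ∃ χ, f χ = a ∧ g χ = b :=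
    exists_congr fun χ => and_congr (hf χ a) (hg χ b)
  have hD : (dGraph Δ n).Adj = fun a b => ∃ χ, f χ = a ∧ g χ = b :=
    funext fun a => funext fun b => propext (hadj a b)
  obtain ⟨c, W, hW, hrow, hcol, hrank⟩ := exists_balanced_coefficients f g
    (G := (dGraph Δ n).toSimpleGraphInclusive)
    (fun χ => by
      rw [← hD]
      exact h.reflTransGen_of_adj ((hadj _ _).2 ⟨χ, rfl, rfl⟩))
    -- The origin of `Δ 0 a` is a loop at `a`: it pairs to zero with all `n k`, which forces equal
    -- source and target.
    (fun a => by
      have h0 : toReal 0 ∈ Δ 0 a := by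
        rw [toReal_zero]
        exact h.nef₁.zero_mem a
      obtain ⟨b, ⟨hb0, hb1⟩, hn⟩ := h.exists_mem_Lam h0
      refine ⟨_, (hf _ _).1 hb0, ((hg _ _).1 hb1).trans ?_⟩
      by_contra hba
      have := hn a
      simp [Ne.symm hba] at this)
    (fun a => by
      have h0 : toReal 0 ∈ Δ 0 a := by
        rw [toReal_zero]
        exact h.nef₁.zero_mem a
      obtain ⟨m, hm0, hm⟩ := h.nef₁.exists_ne_zero a
      obtain ⟨b, ⟨hb, -⟩, -⟩ := h.exists_mem_Lam hm
      obtain ⟨b', ⟨hb', -⟩, -⟩ := h.exists_mem_Lam h0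
      exact ⟨_, _, fun hE => hm0 (congrArg (fun χ : Xi Δ => χ.1.1) hE), (hf _ _).1 hb,
        (hf _ _).1 hb'⟩)
    (fun a b => by
      rw [← hadj, ← hadj]
      exact SimpleGraph.fromRel_adj _ _ _)
  have hWt : wMatrix Δ n (1, c) = W := by
    ext a b
    rw [← hW a b]
    refine finsum_eq_of_bijective (Subtype.map id fun χ hχ => ⟨(hf χ a).1 hχ.1, (hg χ b).1 hχ.2⟩)
      ⟨Subtype.map_injective _ Function.injective_id, fun χ => ?_⟩ fun χ => mul_one _
    exact ⟨⟨χ.1, (hf χ.1 a).2 χ.2.1, (hg χ.1 b).2 χ.2.2⟩, rfl⟩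
  have hR : (wMatrix Δ n (1, c)).rank + beta Δ n = r := by
    rw [hWt]
    exact hrank.trans (Fintype.card_fin r)
  refine ⟨(1, c), ⟨one_mem_S h 0 fun k => ?_, hR⟩, ⟨one_mem_S h 1 fun k => ?_, hR⟩⟩
  · rw [← hrow k]
    exact finsum_comp_equiv (Equiv.subtypeEquivRight fun χ => hf χ k)
      (f := fun χ : {χ // f χ = k} => (c χ : ℂ))
  · rw [← hcol k]
    exact finsum_comp_equiv (Equiv.subtypeEquivRight fun χ => hg χ k)
      (f := fun χ : {χ // g χ = k} => (c χ : ℂ))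

end Mirror

end Characters

end NefMirror

theorem mainTheorem3 {d r : ℕ} (Δ : Fin 2 → Fin r → Set (Fin d → ℝ)) (n : Fin r → Fin d → ℤ)
    (h : NefMirror.IsMultipleMirror (Δ 0) (Δ 1) n) (i : Fin 2) :
    (NefMirror.Omega h i).Nonempty := by
  obtain ⟨t, ht⟩ := NefMirror.exists_mem_R h
  exact ⟨_, t, ht, rfl⟩
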